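/- Let $n\ge 2$ and $k\ge 1$ be integers and let $B_1(0)$ be the open unit ball of $\mathbb{R}^n$. There is a $C^k$ function $f:\mathbb{R}^n\to\mathbb{R}$ such that the Dirichlet problem $$\Delta u(x)=f(x)\ \text{ in } B_1(0),\qquad u(x)=0\ \text{ on } \partial B_1(0),$$ has a unique solution $u$ (among the functions that are continuous on $\overline{B_1(0)}$ and twice differentiable at every point of $B_1(0)$), and this solution is $(k+2)$-times differentiable at every point of $\overline{B_1(0)}$ (at boundary points relative to $\overline{B_1(0)}$), but its derivative $D^{k+2}u$ of order $k+2$ is unbounded on $B_1(0)$. -/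

import Mathlib

open scoped Laplacian

/-- `u` is `m`-times (Fréchet) differentiable at every point of `s`, relative to `s`: for every
`j < m` the `j`-th derivative of `u` relative to `s` is differentiable on `s`; the `m`-th derivative
then exists at every point of `s`, but it need not be continuous or bounded.
It is used for open balls and closed balls of positive radius, on which derivatives are unique. -/
def TimesDifferentiableOn {E : Type*} [NormedAddCommGroup E] [NormedSpace ℝ E]
    (m : ℕ) (u : E → ℝ) (s : Set E) : Prop :=
  ∀ j : ℕ, j < m → DifferentiableOn ℝ (iteratedFDerivWithin ℝ j u s) s

/-- `u` is a solution of the Dirichlet problem `Δ u = f` in the open unit ball of `ℝⁿ`, `u = 0` on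
the unit sphere: it is continuous on the closed ball, twice differentiable at every point of the
open ball, satisfies the equation at every point of the open ball, and vanishes on the sphere.
The values of `u` outside the closed ball are irrelevant. -/
structure IsDirichletSolution {n : ℕ} (f u : EuclideanSpace ℝ (Fin n) → ℝ) : Prop where
  continuousOn : ContinuousOn u (Metric.closedBall 0 1)
  twice_differentiable : TimesDifferentiableOn 2 u (Metric.ball 0 1)
  laplacian_eq : ∀ x ∈ Metric.ball (0 : EuclideanSpace ℝ (Fin n)) 1, (Δ u) x = f x
  boundary_eq : ∀ x ∈ Metric.sphere (0 : EuclideanSpace ℝ (Fin n)) 1, u x = 0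

open Metric Set Filter Topology InnerProductSpace
open scoped ContDiff

/-! Construct `u` first and set `f = Δ u`. Bounds on `D^k Δ` do not control `D^(k+2)` in sup norm. A
cut-off harmonic polynomial of degree `k + 2` has nonzero `D^(k+2)` at the origin, while its
Laplacian lives away from the origin. Summing `N` dilates of it adds up the derivatives at the
origin but keeps the Laplacian terms disjointly supported (`exists_iteratedFDeriv_unbounded`).
Shrinking such a sum around any point gives a bump with small derivatives up to order `k + 1`, small
Laplacian in `C^k`, and `D^(k+2)` as large as desired at its centre (`exists_building_block`).

Disjoint bumps accumulating at the origin sum to `u`. Away from the origin the sum is locally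
finite, hence smooth. At the origin `D^(k+1) u` is quadratically small, hence differentiable,
although `D^(k+2) u` blows up along the centres. Uniqueness is the weak maximum principle, which
needs only pointwise second derivatives. -/

theorem natCast_le_infty (i : ℕ) : (i : ℕ∞ω) ≤ ∞ := by exact_mod_cast le_top

/-! ### The Laplacian as a trace of the second derivative. -/

section Laplacian

variable {E : Type*} [NormedAddCommGroup E] [InnerProductSpace ℝ E] [FiniteDimensional ℝ E]

variable (E) in
/-- The trace of a bilinear form, as a continuous linear functional. -/
noncomputable def traceForm : (E [×2]→L[ℝ] ℝ) →L[ℝ] ℝ :=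
  ∑ i, ContinuousMultilinearMap.apply ℝ (fun _ : Fin 2 ↦ E) ℝ
    ![stdOrthonormalBasis ℝ E i, stdOrthonormalBasis ℝ E i]

theorem laplacian_eq_traceForm (g : E → ℝ) : Δ g = traceForm E ∘ iteratedFDeriv ℝ 2 g := by
  rw [laplacian_eq_iteratedFDeriv_stdOrthonormalBasis]
  ext x
  simp [traceForm]

theorem ContDiff.laplacian {g : E → ℝ} (hg : ContDiff ℝ ∞ g) : ContDiff ℝ ∞ (Δ g) := by
  rw [laplacian_eq_traceForm]
  exact (traceForm E).contDiff.comp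
    (hg.iteratedFDeriv_right (m := ∞) (i := 2) (by norm_cast))

end Laplacian

/-! ### Derivatives under dilation and translation. -/

section Rescaling

variable {E F : Type*} [NormedAddCommGroup E] [NormedSpace ℝ E]
  [NormedAddCommGroup F] [NormedSpace ℝ F]

theorem ContDiff.rescale {g : E → F} (hg : ContDiff ℝ ∞ g) (c s : ℝ) (a : E) :
    ContDiff ℝ ∞ (fun x ↦ c • g (s • (x - a))) :=
  (hg.comp ((contDiff_id.sub contDiff_const).const_smul s)).const_smul c

theorem iteratedFDeriv_rescale {g : E → F} (hg : ContDiff ℝ ∞ g) (c s : ℝ) (a : E) (i : ℕ)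
    (x : E) :
    iteratedFDeriv ℝ i (fun x ↦ c • g (s • (x - a))) x =
      (c * s ^ i) • iteratedFDeriv ℝ i g (s • (x - a)) := by
  have h1 : ContDiff ℝ ∞ (fun z ↦ c • g (s • z)) := by
    simpa using hg.rescale c s 0
  have h2 : ContDiff ℝ ∞ (fun z ↦ g (s • z)) := by
    simpa using hg.rescale 1 s 0
  rw [iteratedFDeriv_comp_sub (f := fun z ↦ c • g (s • z)),
    iteratedFDeriv_const_smul_apply' (h2.of_le (natCast_le_infty _)).contDiffAt,
    iteratedFDeriv_comp_const_smul s (hg.of_le (natCast_le_infty _)), smul_smul]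

end Rescaling

theorem laplacian_rescale {E : Type*} [NormedAddCommGroup E] [InnerProductSpace ℝ E]
    [FiniteDimensional ℝ E] {g : E → ℝ} (hg : ContDiff ℝ ∞ g) (c s : ℝ) (a : E) :
    Δ (fun x ↦ c • g (s • (x - a))) = fun x ↦ (c * s ^ 2) • (Δ g) (s • (x - a)) := by
  ext x
  simp only [laplacian_eq_traceForm, Function.comp_apply, iteratedFDeriv_rescale hg, map_smul]

/-! ### Harmonic polynomials of prescribed degree. -/

section Harmonic

variable {E : Type*} [NormedAddCommGroup E] [InnerProductSpace ℝ E]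

/-- The real part of `(⟪a, x⟫ + i ⟪b, x⟫) ^ m`. -/
noncomputable def planarPower (a b : E) (m : ℕ) (x : E) : ℝ :=
  ((((inner ℝ a x : ℝ) : ℂ) + (inner ℝ b x : ℝ) * Complex.I) ^ m).re

theorem contDiff_planarPower (a b : E) (m : ℕ) : ContDiff ℝ ∞ (planarPower a b m) := by
  have h (c : E) : ContDiff ℝ ∞ fun x : E ↦ ((inner ℝ c x : ℝ) : ℂ) :=
    Complex.ofRealCLM.contDiff.comp (contDiff_const.inner ℝ contDiff_id)
  exact Complex.reCLM.contDiff.comp (((h a).add ((h b).mul contDiff_const)).pow m)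

/-- Along the line spanned by `a` the polynomial is `t ^ m`, whose `m`-th derivative is `m!`. -/
theorem iteratedFDeriv_planarPower_ne_zero {a b : E} (ha : ‖a‖ = 1) (hab : inner ℝ b a = (0 : ℝ))
    (m : ℕ) : iteratedFDeriv ℝ m (planarPower a b m) 0 ≠ 0 := by
  intro h0
  have h1 : planarPower a b m ∘ (ContinuousLinearMap.toSpanSingleton ℝ a) = fun t : ℝ ↦ t ^ m := by
    ext t
    simp only [planarPower, Function.comp_apply, ContinuousLinearMap.toSpanSingleton_apply,
      inner_smul_right, real_inner_self_eq_norm_sq, ha, hab]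
    norm_num
    norm_cast
  have h2 := (ContinuousLinearMap.toSpanSingleton ℝ a).iteratedFDeriv_comp_right
    (contDiff_planarPower a b m) 0 (i := m) (natCast_le_infty _)
  rw [h1, map_zero, h0] at h2
  have h3 : iteratedDeriv m (fun t : ℝ ↦ t ^ m) 0 = 0 := by
    rw [iteratedDeriv_eq_iteratedFDeriv, h2]
    simp
  rw [iteratedDeriv_fun_pow_zero] at h3
  simp [Nat.factorial_ne_zero] at h3

/-- The function factors through a coordinate projection to `ℂ`, where it is the real part of a
holomorphic function; the other basis directions contribute nothing. -/
theorem laplacian_planarPower [FiniteDimensional ℝ E] {ι : Type*} [Fintype ι]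
    (v : OrthonormalBasis ι ℝ E) {p q : ι} (hpq : p ≠ q) (m : ℕ) : Δ (planarPower (v p) (v q) m) = 0 := by
  classical
  set h : ℂ → ℝ := fun z ↦ (z ^ m).re
  have hh : ContDiff ℝ ∞ h := Complex.reCLM.contDiff.comp (contDiff_id.pow m)
  set L : E →L[ℝ] ℂ := Complex.ofRealCLM.comp (innerSL ℝ (v p)) +
    (Complex.ofRealCLM.comp (innerSL ℝ (v q))).smulRight Complex.I with hL
  have hLe (x : E) : L x = ((inner ℝ (v p) x : ℝ) : ℂ) + (inner ℝ (v q) x : ℝ) * Complex.I := by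
    simp [hL]
  have hP : planarPower (v p) (v q) m = h ∘ L := by
    ext x; simp only [Function.comp_apply, hLe, planarPower, h]
  have hLv (i : ι) : L (v i) = if i = p then 1 else if i = q then Complex.I else 0 := by
    rw [hLe]
    simp only [v.inner_eq_ite]
    by_cases hp : i = p
    · subst hp; simp [hpq.symm]
    · by_cases hq : i = q
      · subst hq; simp [hpq, hp]
      · simp [hp, hq, Ne.symm hp, Ne.symm hq]
  ext x
  have hharm := (AnalyticAt.harmonicAt_re (f := fun z ↦ z ^ m) (x := L x)
    (by fun_prop)).2.eq_of_nhds
  rw [laplacian_eq_iteratedFDeriv_complexPlane] at hharm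
  rw [laplacian_eq_iteratedFDeriv_orthonormalBasis _ v]
  have hterm (i : ι) : iteratedFDeriv ℝ 2 (planarPower (v p) (v q) m) x ![v i, v i] =
      iteratedFDeriv ℝ 2 h (L x) ![L (v i), L (v i)] := by
    rw [hP, L.iteratedFDeriv_comp_right hh x (i := 2) (by norm_cast)]
    simp only [ContinuousMultilinearMap.compContinuousLinearMap_apply]
    congr 1
    ext j
    fin_cases j <;> rfl
  simp only [hterm]
  rw [Fintype.sum_eq_add p q hpq]
  · simpa [hLv, hpq.symm] using hharm
  · rintro i ⟨hip, hiq⟩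
    rw [hLv, if_neg hip, if_neg hiq]
    exact (iteratedFDeriv ℝ 2 h (L x)).map_coord_zero 0 rfl

end Harmonic

/-! ### Compact support and local vanishing. -/

section Vanishing

variable {E F : Type*} [NormedAddCommGroup E]

theorem Continuous.exists_norm_le_of_eq_zero [ProperSpace E] [NormedAddCommGroup F] {g : E → F}
    (hg : Continuous g) {R : ℝ} (h0 : ∀ x, R < ‖x‖ → g x = 0) : ∃ C, 0 ≤ C ∧ ∀ x, ‖g x‖ ≤ C := by
  obtain ⟨C, hC⟩ :=
    (isCompact_closedBall (0 : E) R).exists_bound_of_continuousOn hg.continuousOn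
  refine ⟨max C 0, le_max_right _ _, fun x ↦ ?_⟩
  by_cases hx : R < ‖x‖
  · simp [h0 x hx]
  · exact (hC x (by simpa using hx)).trans (le_max_left _ _)

theorem iteratedFDeriv_eq_zero_of_eqOn [NormedSpace ℝ E] [NormedAddCommGroup F] [NormedSpace ℝ F]
    {g : E → F} {U : Set E} (hU : IsOpen U) (h : ∀ x ∈ U, g x = 0) (i : ℕ) :
    ∀ x ∈ U, iteratedFDeriv ℝ i g x = 0 := by
  intro x hx
  have : g =ᶠ[𝓝 x] fun _ ↦ 0 := by filter_upwards [hU.mem_nhds hx] using h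
  rw [(this.iteratedFDeriv ℝ i).eq_of_nhds]
  simp

theorem laplacian_eq_zero_of_eqOn [InnerProductSpace ℝ E] [FiniteDimensional ℝ E]
    {g : E → ℝ} {U : Set E} (hU : IsOpen U) (h : ∀ x ∈ U, g x = 0) : ∀ x ∈ U, (Δ g) x = 0 := by
  intro x hx
  rw [laplacian_eq_traceForm, Function.comp_apply, iteratedFDeriv_eq_zero_of_eqOn hU h 2 x hx,
    map_zero]

end Vanishing

theorem isOpen_lt_norm {E : Type*} [NormedAddCommGroup E] (R : ℝ) : IsOpen {x : E | R < ‖x‖} :=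
  isOpen_lt continuous_const continuous_norm

/-! ### Bumps with large top derivative and small Laplacian. -/

section Building

variable {E : Type*} [NormedAddCommGroup E] [InnerProductSpace ℝ E] [FiniteDimensional ℝ E]

theorem exists_harmonic_germ {ι : Type*} [Fintype ι] [Nontrivial ι] (v : OrthonormalBasis ι ℝ E)
    (m : ℕ) :
    ∃ ψ : E → ℝ, ContDiff ℝ ∞ ψ ∧ (∀ x, 1 < ‖x‖ → ψ x = 0) ∧ iteratedFDeriv ℝ m ψ 0 ≠ 0 ∧
      ∀ x, ‖x‖ < 1 / 2 → (Δ ψ) x = 0 := by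
  obtain ⟨p, q, hpq⟩ := exists_pair_ne ι
  let η : ContDiffBump (0 : E) := ⟨1 / 2, 1, by norm_num, by norm_num⟩
  set P := planarPower (v p) (v q) m
  have hη (x : E) (hx : ‖x‖ < 1 / 2) : (fun x ↦ η x * P x) =ᶠ[𝓝 x] P := by
    filter_upwards [isOpen_ball.mem_nhds (mem_ball_zero_iff.2 hx)] with y hy
    rw [η.one_of_mem_closedBall (ball_subset_closedBall hy), one_mul]
  refine ⟨fun x ↦ η x * P x, η.contDiff.mul (contDiff_planarPower _ _ _), fun x hx ↦ ?_, ?_,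
    fun x hx ↦ ?_⟩
  · simp only
    rw [η.zero_of_le_dist (by simpa [η] using hx.le), zero_mul]
  · rw [((hη 0 (by simp)).iteratedFDeriv ℝ m).eq_of_nhds]
    refine iteratedFDeriv_planarPower_ne_zero (v.norm_eq_one p) ?_ m
    classical
    rw [v.inner_eq_ite, if_neg hpq.symm]
  · rw [(laplacian_congr_nhds (hη x hx)).eq_of_nhds, laplacian_planarPower v hpq, Pi.zero_apply]

/-- Derivatives of order `k + 2` are not controlled by the derivatives of order `k` of the
Laplacian, uniformly over test functions. -/
theorem exists_iteratedFDeriv_unbounded {ι : Type*} [Fintype ι] [Nontrivial ι]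
    (v : OrthonormalBasis ι ℝ E) (k : ℕ) :
    ∃ A : E [×(k + 2)]→L[ℝ] ℝ, A ≠ 0 ∧ ∃ C : ℝ, 0 ≤ C ∧ ∀ N : ℕ, ∃ Ψ : E → ℝ, ContDiff ℝ ∞ Ψ ∧
      (∀ x, 1 < ‖x‖ → Ψ x = 0) ∧ iteratedFDeriv ℝ (k + 2) Ψ 0 = (N : ℝ) • A ∧
      ∀ x, ‖iteratedFDeriv ℝ k (Δ Ψ) x‖ ≤ C := by
  obtain ⟨ψ, hψ, hψ0, hA, hψΔ⟩ := exists_harmonic_germ v (k + 2)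
  have hvanish {g : E → ℝ} (hg : ∀ x, 1 < ‖x‖ → g x = 0) :
      ∀ x, 1 < ‖x‖ → iteratedFDeriv ℝ k (Δ g) x = 0 :=
    iteratedFDeriv_eq_zero_of_eqOn (isOpen_lt_norm 1)
      (laplacian_eq_zero_of_eqOn (isOpen_lt_norm 1) hg) k
  have hG : ∀ x, ‖x‖ < 1 / 2 → iteratedFDeriv ℝ k (Δ ψ) x = 0 :=
    iteratedFDeriv_eq_zero_of_eqOn (U := {x : E | ‖x‖ < 1 / 2})
      (isOpen_lt continuous_norm continuous_const) hψΔ k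
  obtain ⟨C, hC0, hC⟩ := (hψ.laplacian.continuous_iteratedFDeriv
    (m := k) (natCast_le_infty _)).exists_norm_le_of_eq_zero (hvanish hψ0)
  refine ⟨_, hA, C, hC0, fun N ↦ ?_⟩
  induction N with
  | zero =>
    refine ⟨fun _ ↦ 0, contDiff_const, fun _ _ ↦ rfl, by simp, fun x ↦ ?_⟩
    simp [hC0, Pi.zero_def]
  | succ N ih =>
    obtain ⟨Ψ, hΨ, hΨ0, hΨA, hΨC⟩ := ih
    -- With this factor, dilation by 4 preserves both `D^(k+2)` at the origin and the sup norm of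
    -- `D^k Δ`.
    set c : ℝ := ((4 : ℝ)⁻¹) ^ (k + 2) with hc
    have hc4 : c * 4 ^ (k + 2) = 1 := by rw [hc, ← mul_pow]; norm_num
    set Φ : E → ℝ := fun x ↦ c • Ψ ((4 : ℝ) • (x - 0)) with hΦdef
    have hΦ : ContDiff ℝ ∞ Φ := hΨ.rescale c 4 0
    have hnorm (x : E) : ‖(4 : ℝ) • (x - 0)‖ = 4 * ‖x‖ := by rw [norm_smul]; simp
    have hsum : Δ (ψ + Φ) = Δ ψ + Δ Φ := by
      ext x
      exact ContDiffAt.laplacian_add (hψ.of_le (by norm_cast)).contDiffAt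
        (hΦ.of_le (by norm_cast)).contDiffAt
    have hDΦ (x : E) : iteratedFDeriv ℝ k (Δ Φ) x =
        iteratedFDeriv ℝ k (Δ Ψ) ((4 : ℝ) • (x - 0)) := by
      have : c * 4 ^ 2 * 4 ^ k = 1 := by rw [← hc4]; ring
      rw [laplacian_rescale hΨ, iteratedFDeriv_rescale hΨ.laplacian, this, one_smul]
    refine ⟨ψ + Φ, hψ.add hΦ, fun x hx ↦ ?_, ?_, fun x ↦ ?_⟩
    · rw [Pi.add_apply, hψ0 x hx, hΦdef]
      simp only
      rw [hΨ0 _ (by rw [hnorm]; linarith), smul_zero, add_zero]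
    · rw [iteratedFDeriv_add_apply (hψ.of_le (natCast_le_infty _)).contDiffAt
        (hΦ.of_le (natCast_le_infty _)).contDiffAt, iteratedFDeriv_rescale hΨ, hc4, sub_zero,
        smul_zero, hΨA]
      push_cast
      module
    · rw [hsum, iteratedFDeriv_add_apply (hψ.laplacian.of_le (natCast_le_infty _)).contDiffAt
        (hΦ.laplacian.of_le (natCast_le_infty _)).contDiffAt, hDΦ]
      -- At most one summand is nonzero at `x`: the first vanishes inside radius 1/2, the dilated
      -- one outside radius 1/4. So `C` does not grow with `N`.
      rcases lt_or_ge ‖x‖ (1 / 2) with hx | hx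
      · rw [hG x hx, zero_add]
        exact hΨC _
      · rw [hvanish hΨ0 _ (by rw [hnorm]; linarith), add_zero]
        exact hC x

/-- Take `c r^(k+2) Ψ((x - a) / r)`. In the orders `k + 2` for the function and `k` for its
Laplacian the powers of `r` cancel, so `c` controls the Laplacian and `N` then forces the size at
`a`. Every lower order keeps a positive power of `r`, chosen last. -/
theorem exists_building_block {ι : Type*} [Fintype ι] [Nontrivial ι]
    (v : OrthonormalBasis ι ℝ E) (k : ℕ) {ε : ℝ} (hε : 0 < ε) (M : ℝ) (a : E) {ρ : ℝ}
    (hρ : 0 < ρ) :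
    ∃ φ : E → ℝ, ContDiff ℝ ∞ φ ∧ (∀ x, ρ < ‖x - a‖ → φ x = 0) ∧
      M < ‖iteratedFDeriv ℝ (k + 2) φ a‖ ∧
      (∀ i ≤ k + 1, ∀ x, ‖iteratedFDeriv ℝ i φ x‖ ≤ ε) ∧
      ∀ i ≤ k, ∀ x, ‖iteratedFDeriv ℝ i (Δ φ) x‖ ≤ ε := by
  obtain ⟨A, hA, C, hC0, hΨ⟩ := exists_iteratedFDeriv_unbounded v k
  set c : ℝ := ε / (C + 1) with hc
  have hc0 : 0 < c := by positivity
  have hcC : c * C ≤ ε := by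
    rw [hc, div_mul_eq_mul_div, div_le_iff₀ (by positivity)]
    nlinarith
  obtain ⟨N, hN⟩ := exists_nat_gt (M / (c * ‖A‖))
  obtain ⟨Ψ, hΨs, hΨ0, hΨA, hΨC⟩ := hΨ N
  have hA0 : 0 < ‖A‖ := norm_pos_iff.2 hA
  rw [div_lt_iff₀ (by positivity)] at hN
  have h1 (i : ℕ) : ∃ B, 0 ≤ B ∧ ∀ x, ‖iteratedFDeriv ℝ i Ψ x‖ ≤ B :=
    (hΨs.continuous_iteratedFDeriv (m := i) (natCast_le_infty _)).exists_norm_le_of_eq_zero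
      (iteratedFDeriv_eq_zero_of_eqOn (isOpen_lt_norm 1) hΨ0 i)
  have h2 (i : ℕ) : ∃ B, 0 ≤ B ∧ ∀ x, ‖iteratedFDeriv ℝ i (Δ Ψ) x‖ ≤ B :=
    (hΨs.laplacian.continuous_iteratedFDeriv
      (m := i) (natCast_le_infty _)).exists_norm_le_of_eq_zero
      (iteratedFDeriv_eq_zero_of_eqOn (isOpen_lt_norm 1)
        (laplacian_eq_zero_of_eqOn (isOpen_lt_norm 1) hΨ0) i)
  choose B hB0 hB using h1
  choose B' hB'0 hB' using h2
  set K := ∑ i ∈ Finset.range (k + 2), (B i + B' i)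
  have hKi {i : ℕ} (hi : i ≤ k + 1) : B i + B' i ≤ K :=
    Finset.single_le_sum (f := fun i ↦ B i + B' i) (fun i _ ↦ add_nonneg (hB0 i) (hB'0 i))
      (Finset.mem_range.2 (by omega))
  have hK0 : 0 ≤ K := Finset.sum_nonneg fun i _ ↦ add_nonneg (hB0 i) (hB'0 i)
  obtain ⟨r, hr0, hr1, hrρ, hrK⟩ : ∃ r : ℝ, 0 < r ∧ r ≤ 1 ∧ r ≤ ρ ∧ r * (c * K) ≤ ε := by
    refine ⟨min (min 1 ρ) (ε / (c * K + 1)), by positivity,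
      (min_le_left _ _).trans (min_le_left _ _), (min_le_left _ _).trans (min_le_right _ _), ?_⟩
    have : ε / (c * K + 1) * (c * K) ≤ ε := by
      rw [div_mul_eq_mul_div, div_le_iff₀ (by positivity)]
      nlinarith
    exact (mul_le_mul_of_nonneg_right (min_le_right _ _) (by positivity)).trans this
  have hrinv {i j : ℕ} (hij : i ≤ j) : c * r ^ j * r⁻¹ ^ i = c * r ^ (j - i) := by
    rw [mul_assoc, inv_pow, ← div_eq_mul_inv, pow_sub₀ _ hr0.ne' hij, div_eq_mul_inv]
  have hsmall {i j : ℕ} (hij : i < j) {b : ℝ} (hb0 : 0 ≤ b) (hb : b ≤ K) :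
      |c * r ^ j * r⁻¹ ^ i| * b ≤ ε := by
    rw [hrinv hij.le, abs_of_nonneg (by positivity)]
    have : r ^ (j - i) ≤ r := pow_le_of_le_one hr0.le hr1 (by omega)
    calc c * r ^ (j - i) * b ≤ c * r * K := by gcongr
      _ = r * (c * K) := by ring
      _ ≤ ε := hrK
  refine ⟨fun x ↦ (c * r ^ (k + 2)) • Ψ (r⁻¹ • (x - a)), hΨs.rescale _ _ _, fun x hx ↦ ?_, ?_,
    fun i hi x ↦ ?_, fun i hi x ↦ ?_⟩
  · simp only
    rw [hΨ0, smul_zero]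
    rw [norm_smul, Real.norm_of_nonneg (by positivity), inv_mul_eq_div, one_lt_div hr0]
    linarith
  · rw [iteratedFDeriv_rescale hΨs, hrinv le_rfl, Nat.sub_self, pow_zero, mul_one, sub_self,
      smul_zero, hΨA, smul_smul, norm_smul, Real.norm_of_nonneg (by positivity)]
    linarith
  · rw [iteratedFDeriv_rescale hΨs, norm_smul, Real.norm_eq_abs]
    refine (mul_le_mul_of_nonneg_left (hB i _) (abs_nonneg _)).trans
      (hsmall (by omega) (hB0 i) ?_)
    linarith [hKi hi, hB'0 i]
  · rw [laplacian_rescale hΨs, iteratedFDeriv_rescale hΨs.laplacian, norm_smul, Real.norm_eq_abs,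
      mul_assoc _ _ (r⁻¹ ^ i), ← pow_add]
    rcases hi.lt_or_eq with hik | rfl
    · refine (mul_le_mul_of_nonneg_left (hB' i _) (abs_nonneg _)).trans
        (hsmall (by omega) (hB'0 i) ?_)
      linarith [hKi (show i ≤ k + 1 by omega), hB0 i]
    · rw [hrinv (by omega), show i + 2 - (2 + i) = 0 by omega, pow_zero, mul_one,
        abs_of_nonneg hc0.le]
      exact (mul_le_mul_of_nonneg_left (hΨC _) hc0.le).trans hcC

end Building

/-! ### Maximum principle and uniqueness. -/

section MaximumPrinciple

variable {E : Type*} [NormedAddCommGroup E]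

/-- `w` has a second Fréchet derivative at `x`. -/
def TwiceDifferentiableAt [NormedSpace ℝ E] (w : E → ℝ) (x : E) : Prop :=
  (∀ᶠ y in 𝓝 x, DifferentiableAt ℝ w y) ∧ DifferentiableAt ℝ (fderiv ℝ w) x

theorem TwiceDifferentiableAt.add [NormedSpace ℝ E] {v w : E → ℝ} {x : E}
    (hv : TwiceDifferentiableAt v x) (hw : TwiceDifferentiableAt w x) :
    TwiceDifferentiableAt (v + w) x ∧
      fderiv ℝ (fderiv ℝ (v + w)) x = fderiv ℝ (fderiv ℝ v) x + fderiv ℝ (fderiv ℝ w) x := by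
  have h : fderiv ℝ (v + w) =ᶠ[𝓝 x] fderiv ℝ v + fderiv ℝ w := by
    filter_upwards [hv.1, hw.1] with y hvy hwy using fderiv_add hvy hwy
  exact ⟨⟨by filter_upwards [hv.1, hw.1] with y hvy hwy using hvy.add hwy,
    (hv.2.add hw.2).congr_of_eventuallyEq h⟩, by rw [h.fderiv_eq, fderiv_add hv.2 hw.2]⟩

theorem TwiceDifferentiableAt.neg [NormedSpace ℝ E] {v : E → ℝ} {x : E}
    (hv : TwiceDifferentiableAt v x) :
    TwiceDifferentiableAt (-v) x ∧
      fderiv ℝ (fderiv ℝ (-v)) x = -fderiv ℝ (fderiv ℝ v) x := by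
  have h : fderiv ℝ (-v) = -fderiv ℝ v := by
    ext1 y
    exact fderiv_neg
  rw [TwiceDifferentiableAt, h]
  exact ⟨⟨by filter_upwards [hv.1] with y hvy using hvy.neg, hv.2.neg⟩, fderiv_neg⟩

theorem TimesDifferentiableOn.twiceDifferentiableAt [NormedSpace ℝ E] {w : E → ℝ} {s : Set E}
    (hw : TimesDifferentiableOn 2 w s) (hs : IsOpen s) {x : E} (hx : x ∈ s) :
    TwiceDifferentiableAt w x := by
  have h0 : DifferentiableOn ℝ w s :=
    ((continuousMultilinearCurryFin0 ℝ E ℝ).differentiable.comp_differentiableOn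
      (hw 0 two_pos)).congr fun y _ ↦ by simp
  have h1 : DifferentiableOn ℝ (fderiv ℝ w) s :=
    ((continuousMultilinearCurryFin1 ℝ E ℝ).differentiable.comp_differentiableOn
      (hw 1 one_lt_two)).congr fun y hy ↦ by
        ext e
        simp [iteratedFDerivWithin_of_isOpen 1 hs hy]
  refine ⟨?_, (h1 x hx).differentiableAt (hs.mem_nhds hx)⟩
  filter_upwards [hs.mem_nhds hx] with y hy
  exact (h0 y hy).differentiableAt (hs.mem_nhds hy)

theorem IsLocalMax.fderiv_fderiv_nonpos [NormedSpace ℝ E] {w : E → ℝ} {x : E}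
    (hmax : IsLocalMax w x) (hw : TwiceDifferentiableAt w x) (e : E) :
    fderiv ℝ (fderiv ℝ w) x e e ≤ 0 := by
  by_contra! hpos
  set γ : ℝ → E := fun t ↦ x + t • e with hγ
  have hγ0 : γ 0 = x := by simp [hγ]
  have hγd (t : ℝ) : HasDerivAt γ e t := by
    have := ((hasDerivAt_id t).smul_const e).const_add x
    rwa [one_smul] at this
  have hγc : Tendsto γ (𝓝 0) (𝓝 x) := by
    simpa [hγ0] using (hγd 0).continuousAt.tendsto
  have hd : deriv (w ∘ γ) =ᶠ[𝓝 0] fun t ↦ fderiv ℝ w (γ t) e := by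
    filter_upwards [hγc.eventually hw.1] with t ht
    exact (ht.hasFDerivAt.comp_hasDerivAt t (hγd t)).deriv
  have hdd : deriv (deriv (w ∘ γ)) 0 = fderiv ℝ (fderiv ℝ w) x e e := by
    rw [hd.deriv_eq]
    have h1 : HasDerivAt (fun t ↦ fderiv ℝ w (γ t)) (fderiv ℝ (fderiv ℝ w) x e) 0 :=
      HasFDerivAt.comp_hasDerivAt (f := γ) 0 (by rw [hγ0]; exact hw.2.hasFDerivAt) (hγd 0)
    simpa using (h1.clm_apply (hasDerivAt_const 0 e)).deriv
  have hlocmax : IsLocalMax (w ∘ γ) 0 := by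
    filter_upwards [hγc.eventually hmax] with t ht
    simpa [hγ0] using ht
  have hcont : ContinuousAt (w ∘ γ) 0 := by
    refine ContinuousAt.comp ?_ (hγd 0).continuousAt
    rw [hγ0]
    exact hw.1.self_of_nhds.continuousAt
  -- A positive second derivative would make the local maximum also a local minimum, so the function
  -- would be locally constant with second derivative zero.
  have hlocmin : IsLocalMin (w ∘ γ) 0 :=
    isLocalMin_of_deriv_deriv_pos (hdd ▸ hpos) hlocmax.deriv_eq_zero hcont
  have hconst : w ∘ γ =ᶠ[𝓝 0] fun _ ↦ (w ∘ γ) 0 := by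
    filter_upwards [hlocmax, hlocmin] with t h1 h2 using le_antisymm h1 h2
  rw [hconst.deriv.deriv_eq] at hdd
  simp only [deriv_const', deriv_const] at hdd
  linarith

variable [InnerProductSpace ℝ E]

theorem twiceDifferentiableAt_norm_sq (c : ℝ) (x : E) :
    TwiceDifferentiableAt (fun y : E ↦ c * ‖y‖ ^ 2) x ∧
      ∀ e, fderiv ℝ (fderiv ℝ (fun y : E ↦ c * ‖y‖ ^ 2)) x e e = c * (2 * ‖e‖ ^ 2) := by
  have hd (y : E) : HasFDerivAt (fun y : E ↦ c * ‖y‖ ^ 2) (c • (2 • innerSL ℝ y)) y :=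
    (hasStrictFDerivAt_norm_sq y).hasFDerivAt.const_mul c
  have h : fderiv ℝ (fun y : E ↦ c * ‖y‖ ^ 2) =
      fun y ↦ (c • (2 • innerSL ℝ : E →L[ℝ] E →L[ℝ] ℝ)) y := by
    ext1 y
    exact (hd y).fderiv
  refine ⟨⟨Eventually.of_forall fun y ↦ (hd y).differentiableAt, ?_⟩, fun e ↦ ?_⟩
  · rw [h]
    exact ContinuousLinearMap.differentiableAt _
  · rw [h, ContinuousLinearMap.fderiv]
    have : innerSL ℝ e e = ‖e‖ ^ 2 := real_inner_self_eq_norm_sq e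
    simp [this]

theorem laplacian_eq_sum_fderiv [FiniteDimensional ℝ E] (w : E → ℝ) (x : E) :
    (Δ w) x = ∑ i, fderiv ℝ (fderiv ℝ w) x (stdOrthonormalBasis ℝ E i)
      (stdOrthonormalBasis ℝ E i) := by
  simp [laplacian_eq_iteratedFDeriv_stdOrthonormalBasis, iteratedFDeriv_two_apply]

/-- The weak maximum principle for the difference of two solutions of a Poisson equation. -/
theorem le_of_laplacian_eq [FiniteDimensional ℝ E] [Nontrivial E] {u v : E → ℝ}
    (hu : ContinuousOn u (closedBall 0 1)) (hv : ContinuousOn v (closedBall 0 1))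
    (hu2 : ∀ x ∈ ball (0 : E) 1, TwiceDifferentiableAt u x)
    (hv2 : ∀ x ∈ ball (0 : E) 1, TwiceDifferentiableAt v x)
    (hΔ : ∀ x ∈ ball (0 : E) 1, (Δ u) x = (Δ v) x)
    (hbd : ∀ x ∈ sphere (0 : E) 1, u x = v x) : ∀ x ∈ closedBall (0 : E) 1, u x ≤ v x := by
  intro x hx
  refine le_of_forall_pos_le_add fun ε hε ↦ ?_
  -- The quadratic term makes the Laplacian of `w` strictly positive, which excludes an interior
  -- maximum.
  set w : E → ℝ := u + -v + fun y ↦ ε * ‖y‖ ^ 2 with hw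
  have hwc : ContinuousOn w (closedBall 0 1) := (hu.add hv.neg).add (by fun_prop)
  obtain ⟨z, hz, hzmax⟩ := (isCompact_closedBall (0 : E) 1).exists_isMaxOn ⟨x, hx⟩ hwc
  have hzs : z ∈ sphere (0 : E) 1 := by
    by_contra hzs
    have hzb : z ∈ ball (0 : E) 1 := by
      rw [mem_sphere] at hzs
      exact lt_of_le_of_ne hz hzs
    have hmax : IsLocalMax w z := hzmax.isLocalMax (closedBall_mem_nhds_of_mem hzb)
    obtain ⟨h1, h1'⟩ := (hv2 z hzb).neg
    obtain ⟨h2, h2'⟩ := (hu2 z hzb).add h1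
    obtain ⟨h3, h3'⟩ := twiceDifferentiableAt_norm_sq ε z
    obtain ⟨h4, h4'⟩ := h2.add h3
    have hsum : ∑ i, fderiv ℝ (fderiv ℝ w) z (stdOrthonormalBasis ℝ E i)
        (stdOrthonormalBasis ℝ E i) = ε * 2 * Module.finrank ℝ E := by
      have := hΔ z hzb
      rw [laplacian_eq_sum_fderiv, laplacian_eq_sum_fderiv] at this
      simp only [hw, h4', h2', h1', add_apply, neg_apply, Finset.sum_add_distrib, this,
        Finset.sum_neg_distrib, h3', OrthonormalBasis.norm_eq_one]
      simp
      ring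
    have hle := Finset.sum_nonpos fun i (_ : i ∈ Finset.univ) ↦
      hmax.fderiv_fderiv_nonpos h4 (stdOrthonormalBasis ℝ E i)
    rw [hsum] at hle
    have : 0 < Module.finrank ℝ E := Module.finrank_pos
    have : (0 : ℝ) < Module.finrank ℝ E := by exact_mod_cast this
    nlinarith [mul_pos hε this]
  have h := hzmax hx
  have hz1 : ‖z‖ = 1 := by simpa using hzs
  simp only [hw, mem_ofPred_eq, Pi.add_apply, Pi.neg_apply, hbd z hzs, hz1] at h
  nlinarith [mul_nonneg hε.le (sq_nonneg ‖x‖)]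

end MaximumPrinciple

theorem IsDirichletSolution.eqOn {n : ℕ} [NeZero n] {f u v : EuclideanSpace ℝ (Fin n) → ℝ}
    (hu : IsDirichletSolution f u) (hv : IsDirichletSolution f v) : EqOn v u (closedBall 0 1) := by
  have key {u v : EuclideanSpace ℝ (Fin n) → ℝ} (hu : IsDirichletSolution f u)
      (hv : IsDirichletSolution f v) : ∀ x ∈ closedBall 0 1, u x ≤ v x :=
    le_of_laplacian_eq hu.continuousOn hv.continuousOn
      (fun x hx ↦ hu.twice_differentiable.twiceDifferentiableAt isOpen_ball hx)
      (fun x hx ↦ hv.twice_differentiable.twiceDifferentiableAt isOpen_ball hx)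
      (fun x hx ↦ (hu.laplacian_eq x hx).trans (hv.laplacian_eq x hx).symm)
      (fun x hx ↦ (hu.boundary_eq x hx).trans (hv.boundary_eq x hx).symm)
  exact fun x hx ↦ le_antisymm (key hv hu x hx) (key hu hv x hx)

/-! ### Summing bumps that accumulate at the origin. -/

section Series

variable {E : Type*} [NormedAddCommGroup E]

theorem hasFDerivAt_zero_of_norm_le_sq [NormedSpace ℝ E] {F : Type*} [NormedAddCommGroup F]
    [NormedSpace ℝ F] {g : E → F} {C : ℝ} (h : ∀ x, ‖g x‖ ≤ C * ‖x‖ ^ 2) :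
    HasFDerivAt g (0 : E →L[ℝ] F) 0 := by
  have h0 : g 0 = 0 := by simpa using h 0
  rw [hasFDerivAt_iff_isLittleO_nhds_zero]
  simp only [zero_add, h0, sub_zero, zero_apply]
  refine (Asymptotics.IsBigO.of_bound C (Eventually.of_forall fun x ↦ ?_)).trans_isLittleO
    (Asymptotics.isLittleO_norm_pow_id one_lt_two)
  simpa using h x

/-- A series of test functions supported in annuli that shrink to the origin. -/
theorem eventually_tsum_eq_sum {g : ℕ → E → ℝ} {t : ℕ → ℝ} (ht : Tendsto t atTop (𝓝 0))
    (hg : ∀ j y, 9 / 8 * t j < ‖y‖ → g j y = 0) {x : E} (hx : x ≠ 0) :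
    ∃ s : Finset ℕ, (fun y ↦ ∑' j, g j y) =ᶠ[𝓝 x] fun y ↦ ∑ j ∈ s, g j y := by
  have hx0 : 0 < ‖x‖ / 2 := by positivity
  have ht' : Tendsto (fun j ↦ 9 / 8 * t j) atTop (𝓝 0) := by simpa using ht.const_mul (9 / 8)
  obtain ⟨J, hJ⟩ := eventually_atTop.1 (ht'.eventually_lt_const hx0)
  refine ⟨Finset.range J, ?_⟩
  filter_upwards [(isOpen_lt_norm (‖x‖ / 2)).mem_nhds
    (show ‖x‖ / 2 < ‖x‖ by linarith)] with y hy
  refine tsum_eq_sum fun j hj ↦ hg j y ((hJ j ?_).trans hy)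
  simpa using hj

variable [InnerProductSpace ℝ E] [FiniteDimensional ℝ E]

theorem exists_contDiff_laplacian_unbounded {ι : Type*} [Fintype ι] [Nontrivial ι]
    (v : OrthonormalBasis ι ℝ E) {k : ℕ} (hk : 1 ≤ k) :
    ∃ u : E → ℝ, ContDiff ℝ (k + 1 : ℕ) u ∧
      Differentiable ℝ (iteratedFDeriv ℝ (k + 1) u) ∧ ContDiff ℝ (k : ℕ∞) (Δ u) ∧
      (∀ x, ‖x‖ = 1 → u x = 0) ∧
      ∀ C : ℝ, ∃ x ∈ ball (0 : E) 1, C < ‖iteratedFDeriv ℝ (k + 2) u x‖ := by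
  obtain ⟨p⟩ : Nonempty ι := inferInstance
  set t : ℕ → ℝ := fun j ↦ (1 / 2) ^ (j + 1) with ht
  have ht0 (j : ℕ) : 0 < t j := by positivity
  have htanti {i j : ℕ} (hij : i < j) : t j ≤ t i / 2 := by
    have : t i / 2 = (1 / 2) ^ (i + 2) := by simp only [ht]; ring
    rw [this]
    exact pow_le_pow_of_le_one (by norm_num) (by norm_num) (by omega)
  have htle (j : ℕ) : t j ≤ 1 / 2 :=
    pow_le_of_le_one (by norm_num) (by norm_num) (by omega)
  have htlim : Tendsto t atTop (𝓝 0) :=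
    (tendsto_pow_atTop_nhds_zero_of_lt_one (by norm_num) (by norm_num)).comp
      (tendsto_add_atTop_nat 1)
  set a : ℕ → E := fun j ↦ t j • v p with ha
  have hanorm (j : ℕ) : ‖a j‖ = t j := by
    rw [ha, norm_smul, v.norm_eq_one, mul_one, Real.norm_of_nonneg (ht0 j).le]
  -- The bump lives in `7/8 t j ≤ ‖x‖ ≤ 9/8 t j`. The factor `(7/8 t j)^2` thus turns its bound into
  -- one by `‖x‖^2`, and halving `t j` keeps these annuli disjoint.
  have hblock (j : ℕ) := exists_building_block v k
    (show 0 < (1 / 2 : ℝ) ^ j * (7 / 8 * t j) ^ 2 by have := ht0 j; positivity) j (a j)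
    (show 0 < t j / 8 by have := ht0 j; positivity)
  choose φ hφ hφ0 hφM hφε hφΔ using hblock
  have hout {j : ℕ} {x : E} (hx : 9 / 8 * t j < ‖x‖) : φ j x = 0 := by
    refine hφ0 j x ?_
    have := norm_sub_norm_le x (a j)
    rw [hanorm] at this
    linarith
  have hin {j : ℕ} {x : E} (hx : ‖x‖ < 7 / 8 * t j) : φ j x = 0 := by
    refine hφ0 j x ?_
    have := norm_sub_norm_le (a j) x
    rw [hanorm, norm_sub_rev] at this
    linarith
  have hε1 (j : ℕ) : (1 / 2 : ℝ) ^ j * (7 / 8 * t j) ^ 2 ≤ (1 / 2) ^ j := by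
    have := ht0 j
    have := htle j
    exact mul_le_of_le_one_right (by positivity) (pow_le_one₀ (by positivity) (by linarith))
  have hsm : Summable fun j : ℕ ↦ (1 / 2 : ℝ) ^ j := summable_geometric_two
  have hφb (i j : ℕ) (x : E) (hi : (i : ℕ∞) ≤ (k + 1 : ℕ)) :
      ‖iteratedFDeriv ℝ i (φ j) x‖ ≤ (1 / 2 : ℝ) ^ j :=
    (hφε j i (by exact_mod_cast hi) x).trans (hε1 j)
  set u : E → ℝ := fun x ↦ ∑' j, φ j x with hu
  have hφk (j : ℕ) : ContDiff ℝ ((k + 1 : ℕ) : ℕ∞) (φ j) := (hφ j).of_le (natCast_le_infty _)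
  have huC : ContDiff ℝ (k + 1 : ℕ) u := contDiff_tsum hφk (fun _ _ ↦ hsm) hφb
  have hDu (i : ℕ) (hi : i ≤ k + 1) :
      iteratedFDeriv ℝ i u = fun x ↦ ∑' j, iteratedFDeriv ℝ i (φ j) x :=
    iteratedFDeriv_tsum hφk (fun _ _ ↦ hsm) hφb (by exact_mod_cast hi)
  have hsumm (i : ℕ) (hi : i ≤ k + 1) (x : E) : Summable fun j ↦ iteratedFDeriv ℝ i (φ j) x :=
    .of_norm_bounded hsm fun j ↦ hφb i j x (by exact_mod_cast hi)
  -- Termwise application is legitimate since `1 ≤ k` gives `2 ≤ k + 1`, the range of uniform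
  -- convergence.
  have hΔu : Δ u = fun x ↦ ∑' j, (Δ (φ j)) x := by
    ext x
    simp only [laplacian_eq_traceForm, Function.comp_apply, hDu 2 (by omega)]
    exact (traceForm E).map_tsum (hsumm 2 (by omega) x)
  have hpt (j : ℕ) (y : E) :
      ‖iteratedFDeriv ℝ (k + 1) (φ j) y‖ ≤ (1 / 2 : ℝ) ^ j * ‖y‖ ^ 2 := by
    rcases lt_or_ge ‖y‖ (7 / 8 * t j) with hy | hy
    · rw [iteratedFDeriv_eq_zero_of_eqOn (U := {x : E | ‖x‖ < 7 / 8 * t j})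
        (isOpen_lt continuous_norm continuous_const) (fun x hx ↦ hin hx) _ y hy, norm_zero]
      positivity
    · refine (hφε j (k + 1) le_rfl y).trans ?_
      have := ht0 j
      gcongr
  refine ⟨u, huC, fun x ↦ ?_, ?_, fun x hx ↦ ?_, fun C ↦ ?_⟩
  · rcases eq_or_ne x 0 with rfl | hx
    · refine (hasFDerivAt_zero_of_norm_le_sq (C := 2) fun y ↦ ?_).differentiableAt
      rw [hDu (k + 1) le_rfl, ← tsum_geometric_two, ← tsum_mul_right]
      exact tsum_of_norm_bounded (hsm.mul_right _).hasSum (hpt · y)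
    · obtain ⟨s, hs⟩ := eventually_tsum_eq_sum htlim (fun j y ↦ hout) hx
      have hus : ContDiffAt ℝ ∞ u x :=
        (ContDiff.sum fun j _ ↦ hφ j).contDiffAt.congr_of_eventuallyEq hs
      exact hus.differentiableAt_iteratedFDeriv (by exact_mod_cast ENat.natCast_lt_top _)
  · rw [hΔu]
    refine contDiff_tsum (fun j ↦ (hφ j).laplacian.of_le (natCast_le_infty _))
      (fun _ _ ↦ hsm) fun i j x hi ↦ ?_
    exact (hφΔ j i (by exact_mod_cast hi) x).trans (hε1 j)
  · refine (tsum_congr fun j ↦ hout ?_).trans tsum_zero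
    linarith [htle j]
  · obtain ⟨j, hj⟩ := exists_nat_gt C
    refine ⟨a j, by rw [mem_ball_zero_iff, hanorm]; linarith [htle j], ?_⟩
    have hloc : u =ᶠ[𝓝 (a j)] φ j := by
      filter_upwards [ball_mem_nhds (a j) (show 0 < t j / 8 by linarith [ht0 j])] with y hy
      rw [mem_ball_iff_norm] at hy
      have h1 := norm_sub_norm_le y (a j)
      have h2 := norm_sub_norm_le (a j) y
      rw [hanorm] at h1 h2
      rw [norm_sub_rev] at h2
      refine tsum_eq_single j fun i hij ↦ ?_
      have := ht0 i
      have := ht0 j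
      rcases hij.lt_or_gt with h | h
      · exact hin (by linarith [htanti h])
      · exact hout (by linarith [htanti h])
    rw [(hloc.iteratedFDeriv ℝ (k + 2)).eq_of_nhds]
    exact hj.trans (hφM j)

end Series

/-! ### Relative derivatives on the ball, and conclusion. -/

theorem ContDiff.timesDifferentiableOn {E : Type*} [NormedAddCommGroup E] [NormedSpace ℝ E]
    {m : ℕ} {u : E → ℝ} (hu : ContDiff ℝ m u) (hd : Differentiable ℝ (iteratedFDeriv ℝ m u))
    {s : Set E} (hs : UniqueDiffOn ℝ s) : TimesDifferentiableOn (m + 1) u s := by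
  intro j hj
  have hd' : Differentiable ℝ (iteratedFDeriv ℝ j u) := by
    rcases (Nat.lt_succ_iff.1 hj).lt_or_eq with h | rfl
    · exact hu.differentiable_iteratedFDeriv (by exact_mod_cast h)
    · exact hd
  exact hd'.differentiableOn.congr fun x hx ↦ iteratedFDerivWithin_eq_iteratedFDeriv hs
    (hu.of_le (by exact_mod_cast Nat.lt_succ_iff.1 hj)).contDiffAt hx

theorem corollary2 (n : ℕ) (hn : 2 ≤ n) (k : ℕ) (hk : 1 ≤ k) :
    ∃ f : EuclideanSpace ℝ (Fin n) → ℝ, ContDiff ℝ (k : ℕ∞) f ∧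
      ∃ u : EuclideanSpace ℝ (Fin n) → ℝ,
        IsDirichletSolution f u ∧
        (∀ v : EuclideanSpace ℝ (Fin n) → ℝ, IsDirichletSolution f v →
          Set.EqOn v u (Metric.closedBall 0 1)) ∧
        TimesDifferentiableOn (k + 2) u (Metric.closedBall 0 1) ∧
        ∀ C : ℝ, ∃ x ∈ Metric.ball (0 : EuclideanSpace ℝ (Fin n)) 1,
          C < ‖iteratedFDeriv ℝ (k + 2) u x‖ := by
  have : Nontrivial (Fin n) := Fin.nontrivial_iff_two_le.2 hn
  have : NeZero n := ⟨by omega⟩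
  obtain ⟨u, huC, hud, hΔ, hbd, hunb⟩ :=
    exists_contDiff_laplacian_unbounded (EuclideanSpace.basisFun (Fin n) ℝ) hk
  have hsol : IsDirichletSolution (Δ u) u :=
    { continuousOn := huC.continuous.continuousOn
      twice_differentiable := fun j hj ↦
        huC.timesDifferentiableOn hud isOpen_ball.uniqueDiffOn j (by omega)
      laplacian_eq := fun _ _ ↦ rfl
      boundary_eq := fun x hx ↦ hbd x (by simpa using hx) }
  refine ⟨Δ u, hΔ, u, hsol, fun v hv ↦ hsol.eqOn hv,
    huC.timesDifferentiableOn hud (uniqueDiffOn_convex (convex_closedBall _ _) ?_), hunb⟩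
  exact ⟨0, interior_mono ball_subset_closedBall (by simp [isOpen_ball.interior_eq])⟩
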